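/- Let $S$ be a closed connected orientable surface of genus $g\ge 1$ with base point $x_0$, and let $a_1,b_1,\dots,a_g,b_g$ be generators of $\pi_1(S,x_0)$ (for instance the standard ones). Let $p\colon\tilde S\to S$ be a connected covering space with base point $e_0\in p^{-1}(x_0)$, and let $D$ be a group that cannot be generated by fewer than $2g$ elements, together with a short exact sequence $$1\to\pi_1(\tilde S,e_0)\xrightarrow{\,p_*\,}\pi_1(S,x_0)\xrightarrow{\ \phi\ }D\to 1$$ (so $p$ is a regular covering and $D$ is its deck transformation group). Take $\{\phi(a_i),\phi(b_i)\}$ as generating set of $D$. Let $r_1,\dots,r_k$ be words in the letters $a_i,b_i$ (and their inverses) that map to a complete set of defining relations for $D$; that is, the words obtained from the $r_j$ by replacing $a_i,b_i$ by $\phi(a_i),\phi(b_i)$ are the relators of a presentation of $D$ on this generating set. For each $j$ let $c_j\colon S^1\to S$ be a closed curve freely homotopic to a loop at $x_0$ whose class in $\pi_1(S,x_0)$ is the element given by $r_j$. Then the homology classes of the connected components of the preimages of $c_1,\dots,c_k$ under $p$ span $H_1(\tilde S;\mathbb Z)$. Here the preimage of a closed curve $c\colon S^1\to S$, which may have self-intersections,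 is the pullback $\{(z,y)\in S^1\times\tilde S : c(z)=p(y)\}$ together with its projection to $\tilde S$. The homology class of a connected component $K$ of it is the image in $H_1(\tilde S;\mathbb Z)$ of a generator of $H_1(K;\mathbb Z)$; if $K$ is a circle, this class is determined up to sign, and both signs are allowed. -/

import Mathlib

universe u v w

noncomputable section

/-- The point with parameter `t` on the `j`-th side of the closed unit disc, regarded as a polygon
with `4 * g` sides of equal length, numbered counterclockwise from `0` to `4 * g - 1`. -/
def polygonSide (g j : ℕ) (t : unitInterval) : Metric.closedBall (0 : ℂ) 1 :=
  ⟨Complex.exp (((2 * Real.pi * (((j : ℝ) + (t : ℝ)) / (4 * (g : ℝ))) : ℝ) : ℂ) * Complex.I), by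
    rw [mem_closedBall_zero_iff, Complex.norm_exp_ofReal_mul_I]⟩

/-- The side identifications of the polygon with `4 * g` sides whose boundary word is
`a₁ b₁ a₁⁻¹ b₁⁻¹ ⋯ a_g b_g a_g⁻¹ b_g⁻¹`. -/
inductive PolygonGluing (g : ℕ) :
    Metric.closedBall (0 : ℂ) 1 → Metric.closedBall (0 : ℂ) 1 → Prop
  | side_a (i : Fin g) (t : unitInterval) :
      PolygonGluing g (polygonSide g (4 * i) t) (polygonSide g (4 * i + 2) (unitInterval.symm t))
  | side_b (i : Fin g) (t : unitInterval) :
      PolygonGluing g (polygonSide g (4 * i + 1) t)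
        (polygonSide g (4 * i + 3) (unitInterval.symm t))

/-- The standard closed orientable surface of genus `g` (for `1 ≤ g`): the polygon with `4 * g`
sides, glued along its sides, with the quotient topology. (`Quot` divides by the equivalence
relation generated by the identifications.) -/
abbrev StandardSurface (g : ℕ) : Type := Quot (PolygonGluing g)

/-- `S` is a closed, connected, orientable surface of genus `g` (for `1 ≤ g`). -/
def IsClosedOrientableSurface (g : ℕ) (S : Type u) [TopologicalSpace S] : Prop :=
  Nonempty (S ≃ₜ StandardSurface g)

/-- First singular homology with integer coefficients. -/
abbrev H₁ (X : Type u) [TopologicalSpace X] : ModuleCat.{u} ℤ :=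
  ((AlgebraicTopology.singularHomologyFunctor (ModuleCat.{u} ℤ) 1).obj
    (ModuleCat.of ℤ (ULift.{u} ℤ))).obj (TopCat.of X)

/-- The homomorphism induced by a continuous map on first singular homology. -/
def H₁map {X Y : Type u} [TopologicalSpace X] [TopologicalSpace Y] (f : C(X, Y)) :
    H₁ X →ₗ[ℤ] H₁ Y :=
  (((AlgebraicTopology.singularHomologyFunctor (ModuleCat.{u} ℤ) 1).obj
    (ModuleCat.of ℤ (ULift.{u} ℤ))).map (TopCat.ofHom f)).hom

/-- The loop obtained by running once around a closed curve `c : ℝ/ℤ → X`, starting at `c 0`. -/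
def circleLoop {X : Type u} [TopologicalSpace X] (c : C(UnitAddCircle, X)) : Path (c 0) (c 0) where
  toFun t := c ((t : ℝ) : UnitAddCircle)
  continuous_toFun := c.continuous.comp
    ((AddCircle.continuous_mk' (1 : ℝ)).comp continuous_subtype_val)
  source' := by simp
  target' := congrArg c (AddCircle.coe_period (1 : ℝ))

/-- The closed curve `c` represents `γ ∈ π₁(X, x)`: it is freely homotopic to a closed curve
through `x` whose loop at `x` has the class `γ`. -/
def Represents {X : Type u} [TopologicalSpace X] {x : X} (c : C(UnitAddCircle, X))
    (γ : FundamentalGroup X x) : Prop :=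
  ∃ (c' : C(UnitAddCircle, X)) (h : c' 0 = x), ContinuousMap.Homotopic c c' ∧
    FundamentalGroup.fromPath (Path.Homotopic.Quotient.mk ((circleLoop c').cast h.symm h.symm)) = γ

/-- The preimage of a closed curve `c` (which need not be simple) under `p`: the pullback of `p`
along `c`. -/
abbrev CurvePreimage {E : Type u} {X : Type v} [TopologicalSpace E] [TopologicalSpace X]
    (p : C(E, X)) (c : C(UnitAddCircle, X)) : Type u :=
  {q : UnitAddCircle × E // c q.1 = p q.2}

/-- The map to `E` of the connected component through `q` of the preimage of `c`. If `p` is a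
covering map and the component is compact, then the component is a circle and this map is the
closed curve in `E` lifting the appropriate power of `c`. -/
def componentMap {E : Type u} {X : Type v} [TopologicalSpace E] [TopologicalSpace X]
    (p : C(E, X)) (c : C(UnitAddCircle, X)) (q : CurvePreimage p c) :
    C(↥(connectedComponent q), E) where
  toFun z := z.1.1.2
  continuous_toFun :=
    continuous_snd.comp (continuous_subtype_val.comp continuous_subtype_val)

/-- The homology classes in `E` of the connected components of the preimage of `c`: the images of
the generators of the first homology of the components. For a component that is a circle these
are the classes of that circle with its two orientations. -/
def preimageComponentClasses {E : Type u} {X : Type v} [TopologicalSpace E] [TopologicalSpace X]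
    (p : C(E, X)) (c : C(UnitAddCircle, X)) : Set (H₁ E) :=
  {h | ∃ (q : CurvePreimage p c) (y : H₁ ↥(connectedComponent q)),
    Submodule.span ℤ {y} = ⊤ ∧ H₁map (componentMap p c q) y = h}

/-- `R` is a complete set of defining relations for the group `D` on the generating set `X`:
`⟨X | R⟩` is a presentation of `D`. -/
def IsCompleteSetOfDefiningRelations {D : Type w} [Group D] (X : Set D) (R : Set (FreeGroup X)) :
    Prop :=
  Subgroup.closure X = ⊤ ∧
    Subgroup.normalClosure R = (FreeGroup.lift (fun x : X => (x : D))).ker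

end

/-! Since $D$ has no generating set with fewer than $2g$ elements, the $2g$ letters have distinct
images in $D$. Relators on the set of images are therefore relators on the letters, and pushing them
forward from the free group to $\pi_1(S)$ shows that $\ker\phi$ is the normal closure of the classes
of the $r_j$ (`ker_lift_eq_normalClosure`, `ker_eq_normalClosure`).

So $p_*\pi_1(\tilde S)$ is generated, as a plain group, by the conjugates $g r_j g^{-1}$. Each of
these is $p_*$ of an element of $\pi_1(\tilde S)$ whose homology class is that of a closed lift of
$c_j$ (`exists_lift_of_conj`). Such a lift traverses a whole component of the preimage exactly once
(`loopClass_mem_preimageComponentClasses`). As $p_*$ is injective and classes of based loops span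
$H_1(\tilde S)$ (`span_loopClass`), the component classes span. -/

noncomputable section

open CategoryTheory Simplicial

/-! ### Paths as singular 1-chains modulo boundaries -/

section SingularOneChains

variable {X : Type u} [TopologicalSpace X]
  {V : Type*} [AddCommGroup V] [Module ℝ V] [TopologicalSpace V] [ContinuousAdd V]
  [ContinuousSMul ℝ V]

/-- The coefficient module of `H₁`. -/
abbrev coeffModule : ModuleCat.{u} ℤ := ModuleCat.of ℤ (ULift.{u} ℤ)

/-- The singular simplicial set of `X`. -/
abbrev singularSet (X : Type u) [TopologicalSpace X] : SSet.{u} := TopCat.toSSet.obj (TopCat.of X)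

/-- The singular chain complex of `X` with integral coefficients. -/
abbrev singularChains (X : Type u) [TopologicalSpace X] : ChainComplex (ModuleCat.{u} ℤ) ℕ :=
  (singularSet X).chainComplex coeffModule

/-- The `n`-chain given by a single singular simplex. -/
def simplexChain {n : ℕ} (s : singularSet X _⦋n⦌) : (singularChains X).X n :=
  ((singularSet X).ιChainComplex (R := coeffModule) s).hom ⟨1⟩

theorem d_simplexChain_one (s : singularSet X _⦋1⦌) :
    ((singularChains X).d 1 0).hom (simplexChain s) =
      simplexChain ((singularSet X).δ 0 s) - simplexChain ((singularSet X).δ 1 s) := by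
  have h := (singularSet X).ιChainComplex_d (R := coeffModule) s
  rw [Fin.sum_univ_two] at h
  simp only [Fin.val_zero, pow_zero, one_smul, Fin.val_one, pow_one, neg_smul,
    ← sub_eq_add_neg] at h
  exact congrArg (fun f => f.hom (⟨1⟩ : ULift.{u} ℤ)) h

theorem d_simplexChain_two (s : singularSet X _⦋2⦌) :
    ((singularChains X).d 2 1).hom (simplexChain s) =
      simplexChain ((singularSet X).δ 0 s) - simplexChain ((singularSet X).δ 1 s) +
        simplexChain ((singularSet X).δ 2 s) := by
  have h := (singularSet X).ιChainComplex_d (R := coeffModule) s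
  rw [Fin.sum_univ_three] at h
  simp only [Fin.val_zero, pow_zero, one_smul, Fin.val_one, pow_one, neg_smul, Fin.val_two,
    even_two, Even.neg_pow, one_pow, ← sub_eq_add_neg] at h
  exact congrArg (fun f => f.hom (⟨1⟩ : ULift.{u} ℤ)) h

/-- Linear maps out of singular chains agree if they agree on simplices. -/
theorem singularChains_hom_ext {n : ℕ} {M : ModuleCat.{u} ℤ}
    {f g : (singularChains X).X n ⟶ M}
    (h : ∀ s : singularSet X _⦋n⦌, f.hom (simplexChain s) = g.hom (simplexChain s)) : f = g := by
  refine SSet.chainComplex_hom_ext fun s => ?_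
  refine ModuleCat.hom_ext (LinearMap.ext fun x => ?_)
  -- A map out of a copy of ℤ is determined by the image of its generator.
  have hx : x = x.down • (⟨1⟩ : ULift.{u} ℤ) := by ext; simp
  rw [hx]
  refine (map_zsmul ((singularSet X).ιChainComplex s ≫ f).hom _ _).trans (Eq.trans ?_
    (map_zsmul ((singularSet X).ιChainComplex s ≫ g).hom _ _).symm)
  exact congrArg (x.down • ·) (h s)

/-- The linear map out of singular chains with given values on simplices. -/
theorem exists_singularChains_hom {n : ℕ} {M : ModuleCat.{u} ℤ} (F : singularSet X _⦋n⦌ → M) :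
    ∃ f : (singularChains X).X n ⟶ M, ∀ s, f.hom (simplexChain s) = F s := by
  let F' : ∀ _ : singularSet X _⦋n⦌, (coeffModule : ModuleCat.{u} ℤ) ⟶ M := fun s =>
    ModuleCat.ofHom ((LinearMap.toSpanSingleton ℤ M (F s)).comp
      (ULift.moduleEquiv : ULift.{u} ℤ ≃ₗ[ℤ] ℤ).toLinearMap)
  refine ⟨Limits.Cofan.IsColimit.desc
    ((singularSet X).isColimitChainComplexXCofan coeffModule n) F', fun s => ?_⟩
  have h := congrArg (fun f => f.hom (⟨1⟩ : ULift.{u} ℤ)) (Limits.Cofan.IsColimit.fac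
    ((singularSet X).isColimitChainComplexXCofan coeffModule n) F' s)
  refine Eq.trans h ?_
  exact LinearMap.toSpanSingleton_apply_one ℤ M (F s)

omit [TopologicalSpace V] [ContinuousAdd V] [ContinuousSMul ℝ V] in
theorem sum_stdSimplex_map_smul {m n : ℕ} (f : Fin m → Fin n) (t : stdSimplex ℝ (Fin m))
    (v : Fin n → V) : ∑ j, stdSimplex.map f t j • v j = ∑ i, t i • v (f i) := by
  simp only [stdSimplex.map_coe, FunOnFinite.linearMap_apply_apply, Finset.sum_smul]
  rw [← Finset.sum_fiberwise Finset.univ f]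
  refine Finset.sum_congr rfl fun j _ => Finset.sum_congr rfl fun i hi => ?_
  rw [(Finset.mem_filter.1 hi).2]

/-- The singular simplex `t ↦ f (∑ i, t i • v i)`. -/
def affineSimplex {n : ℕ} (f : C(V, X)) (v : Fin (n + 1) → V) : singularSet X _⦋n⦌ :=
  ((TopCat.of X).toSSetObjEquiv _).symm
    ⟨fun t : stdSimplex ℝ (Fin (n + 1)) => f (∑ i, t i • v i), by
      refine f.continuous.comp (continuous_finsetSum _ fun i _ => Continuous.smul ?_ continuous_const)
      exact (continuous_apply i).comp continuous_subtype_val⟩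

theorem δ_affineSimplex {n : ℕ} (f : C(V, X)) (v : Fin (n + 2) → V) (i : Fin (n + 2)) :
    (singularSet X).δ i (affineSimplex f v) = affineSimplex f (v ∘ i.succAbove) := by
  refine ((TopCat.of X).toSSetObjEquiv _).injective ?_
  ext t
  exact congrArg f (sum_stdSimplex_map_smul i.succAbove t v)

theorem affineSimplex_congr {n : ℕ} {W : Type*} [AddCommGroup W] [Module ℝ W] [TopologicalSpace W]
    [ContinuousAdd W] [ContinuousSMul ℝ W] {f : C(V, X)} {g : C(W, X)} {v : Fin (n + 1) → V}
    {w : Fin (n + 1) → W}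
    (h : ∀ t : stdSimplex ℝ (Fin (n + 1)), f (∑ i, t i • v i) = g (∑ i, t i • w i)) :
    affineSimplex f v = affineSimplex g w := by
  unfold affineSimplex
  congr 1
  ext t
  exact h t

/-- The class modulo boundaries of the singular `1`-simplex `s`. -/
def edgeClass (s : singularSet X _⦋1⦌) : (singularChains X).opcycles 1 :=
  ((singularChains X).pOpcycles 1).hom (simplexChain s)

theorem edgeClass_triangle (s : singularSet X _⦋2⦌) :
    edgeClass ((singularSet X).δ 2 s) + edgeClass ((singularSet X).δ 0 s) =
      edgeClass ((singularSet X).δ 1 s) := by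
  have h := congrArg (fun f => f.hom (simplexChain s)) ((singularChains X).d_pOpcycles 2 1)
  have h' : ((singularChains X).pOpcycles 1).hom
      (((singularChains X).d 2 1).hom (simplexChain s)) = 0 := h
  rw [d_simplexChain_two, map_add, map_sub] at h'
  unfold edgeClass
  rw [← sub_eq_zero, ← h']
  abel

/-- The class modulo boundaries of the image under `f` of the segment from `a` to `b`. -/
def segmentClass (f : C(V, X)) (a b : V) : (singularChains X).opcycles 1 :=
  edgeClass (affineSimplex f ![a, b])

/-- The image of the affine triangle with vertices `a`, `b`, `c` is a 2-simplex whose faces are the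
three segments. All later relations between paths come from this one. -/
theorem segmentClass_add (f : C(V, X)) (a b c : V) :
    segmentClass f a b + segmentClass f b c = segmentClass f a c := by
  have h := edgeClass_triangle (affineSimplex f ![a, b, c])
  simp only [δ_affineSimplex] at h
  convert h using 3 <;> unfold segmentClass <;> congr 2 <;> ext i <;> fin_cases i <;> rfl

theorem segmentClass_self (f : C(V, X)) (a : V) : segmentClass f a a = 0 := by
  simpa using segmentClass_add f a a a

theorem segmentClass_congr {W : Type*} [AddCommGroup W] [Module ℝ W] [TopologicalSpace W]
    [ContinuousAdd W] [ContinuousSMul ℝ W] {f : C(V, X)} {g : C(W, X)} {a b : V} {a' b' : W}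
    (h : ∀ t ∈ unitInterval, f ((1 - t) • a + t • b) = g ((1 - t) • a' + t • b')) :
    segmentClass f a b = segmentClass g a' b' := by
  unfold segmentClass
  refine congrArg edgeClass (affineSimplex_congr fun t => ?_)
  have h0 : t 0 = 1 - t 1 := by rw [← stdSimplex.add_eq_one t]; ring
  simpa [Fin.sum_univ_two, h0] using h (t 1) ⟨stdSimplex.zero_le t 1, stdSimplex.le_one t 1⟩

theorem segmentClass_const {f : C(V, X)} {a b : V}
    (h : ∀ t ∈ unitInterval, f ((1 - t) • a + t • b) = f a) : segmentClass f a b = 0 := by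
  rw [← segmentClass_self f a]
  refine segmentClass_congr fun t ht => ?_
  rw [h t ht, ← add_smul, sub_add_cancel, one_smul]

/-- The extension of a path to the real line, constant outside of the unit interval. -/
def Path.extendMap {x y : X} (γ : Path x y) : C(ℝ, X) := ⟨γ.extend, γ.continuous_extend⟩

theorem Path.extendMap_apply {x y : X} (γ : Path x y) {t : ℝ} (ht : t ∈ unitInterval) :
    γ.extendMap t = γ ⟨t, ht⟩ := γ.extend_apply ht

/-- The singular `1`-simplex given by a path. -/
def pathSimplex {x y : X} (γ : Path x y) : singularSet X _⦋1⦌ :=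
  affineSimplex γ.extendMap ![0, 1]

/-- The class modulo boundaries of a path. -/
def pathClass {x y : X} (γ : Path x y) : (singularChains X).opcycles 1 :=
  segmentClass γ.extendMap 0 1

theorem pathClass_eq_segmentClass {x y : X} {γ : Path x y} {f : C(V, X)} {a b : V}
    (h : ∀ t : unitInterval, γ t = f ((1 - (t : ℝ)) • a + (t : ℝ) • b)) :
    pathClass γ = segmentClass f a b := by
  refine segmentClass_congr fun t ht => ?_
  rw [← h ⟨t, ht⟩, ← γ.extendMap_apply ht]
  simp

theorem pathClass_congr {x y x' y' : X} {γ : Path x y} {γ' : Path x' y'} (h : ∀ t, γ t = γ' t) :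
    pathClass γ = pathClass γ' := by
  refine pathClass_eq_segmentClass fun t => ?_
  rw [h t]
  simp [γ'.extendMap_apply t.2]

theorem pathClass_refl (x : X) : pathClass (Path.refl x) = 0 :=
  segmentClass_const fun t _ => by simp [Path.extendMap]

/-- The two factors are the restrictions of the concatenation to the two halves of the interval, so
additivity of segments applies. -/
theorem pathClass_trans {x y z : X} (γ : Path x y) (δ : Path y z) :
    pathClass (γ.trans δ) = pathClass γ + pathClass δ := by
  have h1 : pathClass γ = segmentClass (γ.trans δ).extendMap 0 (1 / 2) := by
    refine pathClass_eq_segmentClass fun t => ?_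
    have ht : (t : ℝ) / 2 ∈ unitInterval := ⟨by linarith [t.2.1], by linarith [t.2.2]⟩
    have e : (1 - (t : ℝ)) • (0 : ℝ) + (t : ℝ) • (1 / 2 : ℝ) = t / 2 := by simp; ring
    rw [e, Path.extendMap_apply _ ht, Path.trans_apply, dif_pos (by simpa using by linarith [t.2.2])]
    congr 1
    ext
    simp
    ring
  have h2 : pathClass δ = segmentClass (γ.trans δ).extendMap (1 / 2) 1 := by
    refine pathClass_eq_segmentClass fun t => ?_
    have ht : (1 + (t : ℝ)) / 2 ∈ unitInterval :=
      ⟨by linarith [t.2.1], by linarith [t.2.2]⟩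
    have e : (1 - (t : ℝ)) • (1 / 2 : ℝ) + (t : ℝ) • (1 : ℝ) = (1 + t) / 2 := by
      simp; ring
    rw [e, Path.extendMap_apply _ ht]
    -- `Path.trans` assigns the midpoint to its first half, so the start of `δ` needs separate
    -- treatment.
    by_cases h0 : (t : ℝ) = 0
    · obtain rfl : t = 0 := Subtype.ext h0
      rw [Path.trans_apply, dif_pos (by simp)]
      simp
    · have : 0 < (t : ℝ) := lt_of_le_of_ne t.2.1 (Ne.symm h0)
      rw [Path.trans_apply, dif_neg (by simp; linarith)]
      congr 1
      ext
      simp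
      ring
  rw [h1, h2, segmentClass_add]
  rfl

theorem pathClass_symm {x y : X} (γ : Path x y) : pathClass γ.symm = -pathClass γ := by
  rw [eq_neg_iff_add_eq_zero, ← segmentClass_self γ.extendMap 1,
    ← segmentClass_add γ.extendMap 1 0 1]
  congr 1
  refine pathClass_eq_segmentClass fun t => ?_
  have e : (1 - (t : ℝ)) • (1 : ℝ) + (t : ℝ) • (0 : ℝ) = 1 - t := by simp
  rw [e, Path.extendMap_apply _ ⟨by linarith [t.2.2], by linarith [t.2.1]⟩]
  rfl

/-- The boundary of a square, as a relation between the classes of its sides. -/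
theorem pathClass_square {x y z w : X} {γ : Path x y} {γ' : Path z w} {δ : Path x z} {δ' : Path y w}
    (F : C(unitInterval × unitInterval, X)) (h0 : ∀ t, F (0, t) = γ t) (h1 : ∀ t, F (1, t) = γ' t)
    (h0' : ∀ s, F (s, 0) = δ s) (h1' : ∀ s, F (s, 1) = δ' s) :
    pathClass γ + pathClass δ' = pathClass δ + pathClass γ' := by
  let f : C(ℝ × ℝ, X) := F.comp
    ⟨Prod.map (Set.projIcc 0 1 zero_le_one) (Set.projIcc 0 1 zero_le_one), by fun_prop⟩
  have hf : ∀ s t : unitInterval, f ((s : ℝ), (t : ℝ)) = F (s, t) := fun s t => by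
    simp [f, Set.projIcc_val]
  have e0 : pathClass γ = segmentClass f (0, 0) (0, 1) :=
    pathClass_eq_segmentClass fun t => by simpa [h0] using (hf 0 t).symm
  have e1 : pathClass γ' = segmentClass f (1, 0) (1, 1) :=
    pathClass_eq_segmentClass fun t => by simpa [h1] using (hf 1 t).symm
  have e0' : pathClass δ = segmentClass f (0, 0) (1, 0) :=
    pathClass_eq_segmentClass fun t => by simpa [h0'] using (hf t 0).symm
  have e1' : pathClass δ' = segmentClass f (0, 1) (1, 1) :=
    pathClass_eq_segmentClass fun t => by simpa [h1'] using (hf t 1).symm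
  -- Both sides equal the class of the diagonal from `(0, 0)` to `(1, 1)`.
  rw [e0, e1, e0', e1', segmentClass_add, segmentClass_add]

/-- A homotopy rel endpoints is a square with two constant sides, which contribute zero. -/
theorem pathClass_eq_of_homotopic {x y : X} {γ γ' : Path x y} (h : γ.Homotopic γ') :
    pathClass γ = pathClass γ' := by
  obtain ⟨F⟩ := h
  simpa [pathClass_refl] using pathClass_square (δ := Path.refl x) (δ' := Path.refl y)
    F.toContinuousMap (fun t => F.apply_zero t) (fun t => F.apply_one t)
    (fun s => F.source s) (fun s => F.target s)

end SingularOneChains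

/-! ### The Hurewicz homomorphism and generation of first homology by loops -/

section Hurewicz

variable {X Y : Type u} [TopologicalSpace X] [TopologicalSpace Y]

/-- The inclusion of `H₁` into chains modulo boundaries. -/
def H₁ι (X : Type u) [TopologicalSpace X] : H₁ X →ₗ[ℤ] (singularChains X).opcycles 1 :=
  ((singularChains X).homologyι 1).hom

theorem H₁ι_injective : Function.Injective (H₁ι X) :=
  (ModuleCat.mono_iff_injective ((singularChains X).homologyι 1)).1 inferInstance

theorem exists_cycle (h : H₁ X) : ∃ z : (singularChains X).X 1,
    ((singularChains X).d 1 0).hom z = 0 ∧ ((singularChains X).pOpcycles 1).hom z = H₁ι X h := by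
  obtain ⟨w, rfl⟩ := (ModuleCat.epi_iff_surjective ((singularChains X).homologyπ 1)).1
    inferInstance h
  refine ⟨((singularChains X).iCycles 1).hom w, ?_, ?_⟩
  · exact congrArg (fun f => f.hom w) ((singularChains X).iCycles_d 1 0)
  · exact (congrArg (fun f => f.hom w) ((singularChains X).homology_π_ι 1)).symm

/-- The map from ℤ with value `z` at the generator lifts to the cycles and then projects to
homology. -/
theorem exists_H₁ι_eq_of_d_eq_zero {z : (singularChains X).X 1}
    (hz : ((singularChains X).d 1 0).hom z = 0) :
    ∃ h : H₁ X, H₁ι X h = ((singularChains X).pOpcycles 1).hom z := by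
  let k : coeffModule ⟶ (singularChains X).X 1 :=
    ModuleCat.ofHom ((LinearMap.toSpanSingleton ℤ _ z).comp
      (ULift.moduleEquiv : ULift.{u} ℤ ≃ₗ[ℤ] ℤ).toLinearMap)
  have hk1 : k.hom ⟨1⟩ = z := LinearMap.toSpanSingleton_apply_one ℤ _ z
  have hk : k ≫ (singularChains X).d 1 0 = 0 := by
    refine ModuleCat.hom_ext (LinearMap.ext fun x => ?_)
    have hx : x = x.down • (⟨1⟩ : ULift.{u} ℤ) := by ext; simp
    rw [hx]
    refine (map_zsmul (k ≫ (singularChains X).d 1 0).hom _ _).trans ?_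
    have h0 : (k ≫ (singularChains X).d 1 0).hom ⟨1⟩ = 0 := by
      rw [← hz, ← hk1]
      rfl
    rw [h0]
    exact zsmul_zero x.down
  let c := (singularChains X).liftCycles k 0 (by simp) hk
  refine ⟨((singularChains X).homologyπ 1).hom (c.hom ⟨1⟩), ?_⟩
  have h1 := congrArg (fun f => f.hom (c.hom ⟨1⟩)) ((singularChains X).homology_π_ι 1)
  have h2 := congrArg (fun f => f.hom (⟨1⟩ : ULift.{u} ℤ))
    ((singularChains X).liftCycles_i k 0 (by simp) hk)
  refine Eq.trans h1 ?_
  rw [← hk1]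
  exact congrArg ((singularChains X).pOpcycles 1).hom h2

theorem H₁ι_map (f : C(X, Y)) (h : H₁ X) :
    H₁ι Y (H₁map f h) = (HomologicalComplex.opcyclesMap
      (SSet.chainComplexMap (TopCat.toSSet.map (TopCat.ofHom f)) coeffModule) 1).hom (H₁ι X h) :=
  congrArg (fun g => g.hom h) (HomologicalComplex.homologyι_naturality
    (SSet.chainComplexMap (TopCat.toSSet.map (TopCat.ofHom f)) coeffModule) 1)

theorem opcyclesMap_edgeClass (f : C(X, Y)) (s : singularSet X _⦋1⦌) :
    (HomologicalComplex.opcyclesMap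
      (SSet.chainComplexMap (TopCat.toSSet.map (TopCat.ofHom f)) coeffModule) 1).hom
        (edgeClass s) = edgeClass ((TopCat.toSSet.map (TopCat.ofHom f)).app _ s) := by
  have h1 := congrArg (fun g => g.hom (simplexChain s)) (HomologicalComplex.p_opcyclesMap
    (SSet.chainComplexMap (TopCat.toSSet.map (TopCat.ofHom f)) coeffModule) 1)
  have h2 := congrArg (fun g => g.hom (⟨1⟩ : ULift.{u} ℤ))
    (SSet.ι_chainComplexMap_f _ _ (TopCat.toSSet.map (TopCat.ofHom f)) coeffModule s)
  exact Eq.trans h1 (congrArg ((singularChains Y).pOpcycles 1).hom h2)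

theorem opcyclesMap_pathClass (f : C(X, Y)) {x y : X} (γ : Path x y) :
    (HomologicalComplex.opcyclesMap
      (SSet.chainComplexMap (TopCat.toSSet.map (TopCat.ofHom f)) coeffModule) 1).hom
        (pathClass γ) = pathClass (γ.map f.continuous) :=
  opcyclesMap_edgeClass f _

theorem d_pathSimplex {x y : X} (γ : Path x y) :
    ((singularChains X).d 1 0).hom (simplexChain (pathSimplex γ)) =
      simplexChain (TopCat.toSSetObj₀Equiv.symm y) -
        simplexChain (TopCat.toSSetObj₀Equiv.symm x) := by
  rw [d_simplexChain_one]
  congr 2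
  · refine TopCat.toSSetObj₀Equiv.injective ?_
    rw [Equiv.apply_symm_apply, pathSimplex, δ_affineSimplex]
    change γ.extend (∑ i : Fin 1, (default : stdSimplex ℝ (Fin 1)) i •
      (![0, 1] : Fin 2 → ℝ) ((0 : Fin 2).succAbove i)) = y
    simp
  · refine TopCat.toSSetObj₀Equiv.injective ?_
    rw [Equiv.apply_symm_apply, pathSimplex, δ_affineSimplex]
    change γ.extend (∑ i : Fin 1, (default : stdSimplex ℝ (Fin 1)) i •
      (![0, 1] : Fin 2 → ℝ) ((1 : Fin 2).succAbove i)) = x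
    simp

theorem exists_loopClass {x : X} (γ : Path x x) : ∃ h : H₁ X, H₁ι X h = pathClass γ :=
  exists_H₁ι_eq_of_d_eq_zero (z := simplexChain (pathSimplex γ)) (by rw [d_pathSimplex, sub_self])

/-- The homology class of a loop. -/
def loopClass {x : X} (γ : Path x x) : H₁ X := (exists_loopClass γ).choose

theorem H₁ι_loopClass {x : X} (γ : Path x x) : H₁ι X (loopClass γ) = pathClass γ :=
  (exists_loopClass γ).choose_spec

theorem loopClass_congr {x y : X} {γ : Path x x} {δ : Path y y} (h : pathClass γ = pathClass δ) :
    loopClass γ = loopClass δ :=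
  H₁ι_injective (by rw [H₁ι_loopClass, H₁ι_loopClass, h])

theorem H₁map_loopClass (f : C(X, Y)) {x : X} (γ : Path x x) :
    H₁map f (loopClass γ) = loopClass (γ.map f.continuous) :=
  H₁ι_injective (by rw [H₁ι_map, H₁ι_loopClass, H₁ι_loopClass, opcyclesMap_pathClass])

theorem loopClass_trans {x : X} (γ δ : Path x x) :
    loopClass (γ.trans δ) = loopClass γ + loopClass δ :=
  H₁ι_injective (by simp only [map_add, H₁ι_loopClass, pathClass_trans])

theorem loopClass_refl (x : X) : loopClass (Path.refl x) = 0 :=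
  H₁ι_injective (by rw [map_zero, H₁ι_loopClass, pathClass_refl])

/-- Freely homotopic closed curves have the same homology class. -/
theorem loopClass_circleLoop_eq {c c' : C(UnitAddCircle, X)} (h : c.Homotopic c') :
    loopClass (circleLoop c) = loopClass (circleLoop c') := by
  obtain ⟨F⟩ := h
  refine loopClass_congr ?_
  let F' : C(unitInterval × unitInterval, X) :=
    F.toContinuousMap.comp ⟨fun q => (q.1, ((q.2 : ℝ) : UnitAddCircle)), by fun_prop⟩
  let δ : Path (c 0) (c' 0) := ⟨⟨fun s => F (s, 0), by fun_prop⟩, by simp, by simp⟩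
  have := pathClass_square (γ := circleLoop c) (γ' := circleLoop c') (δ := δ) (δ' := δ) F'
    (fun t => F.apply_zero _) (fun t => F.apply_one _) (fun s => rfl)
    (fun s => congrArg (fun z => F (s, z)) (AddCircle.coe_period (1 : ℝ)))
  -- The lateral sides of the square are both the track `δ` of the base point, so they cancel.
  rw [add_comm] at this
  exact add_left_cancel this

/-- The Hurewicz homomorphism. -/
def hurewicz (X : Type u) [TopologicalSpace X] (x : X) :
    FundamentalGroup X x →* Multiplicative (H₁ X) where
  toFun γ := Multiplicative.ofAdd (Quotient.lift (fun γ : Path x x => loopClass γ)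
    (fun _ _ h => loopClass_congr (pathClass_eq_of_homotopic h)) γ)
  map_one' := congrArg Multiplicative.ofAdd (loopClass_refl x)
  map_mul' γ δ := by
    induction γ using Quotient.inductionOn
    induction δ using Quotient.inductionOn
    -- The product in the fundamental group concatenates in the reverse order, which commutativity
    -- of homology absorbs.
    exact congrArg Multiplicative.ofAdd ((loopClass_trans _ _).trans (add_comm _ _))

theorem hurewicz_mk {x : X} (γ : Path x x) :
    hurewicz X x (FundamentalGroup.fromPath (Path.Homotopic.Quotient.mk γ)) =
      Multiplicative.ofAdd (loopClass γ) := rfl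

theorem exists_pathSimplex_eq (s : singularSet X _⦋1⦌) :
    ∃ (x y : X) (γ : Path x y), pathSimplex γ = s := by
  let g := (TopCat.of X).toSSetObjEquiv _ s
  let γ : C(unitInterval, X) := g.comp (toContinuousMap stdSimplexHomeomorphUnitInterval.symm)
  let δ : Path (γ 0) (γ 1) := ⟨γ, rfl, rfl⟩
  refine ⟨_, _, δ, ((TopCat.of X).toSSetObjEquiv _).injective (ContinuousMap.ext fun t => ?_)⟩
  have ht : (∑ i : Fin 2, t i • (![0, 1] : Fin 2 → ℝ) i) =
      (stdSimplexHomeomorphUnitInterval t : ℝ) := by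
    rw [Fin.sum_univ_two]
    simp
    rfl
  change δ.extend (∑ i : Fin 2, t i • (![0, 1] : Fin 2 → ℝ) i) = g t
  rw [ht, Path.extend_apply _ (stdSimplexHomeomorphUnitInterval t).2]
  exact congrArg g (stdSimplexHomeomorphUnitInterval.symm_apply_apply t)

/-- Modulo `N` the map vanishes on every simplex, hence is zero. -/
theorem mem_of_simplexChain_mem {n : ℕ} {M : ModuleCat.{u} ℤ} (f : (singularChains X).X n ⟶ M)
    (N : Submodule ℤ M) (h : ∀ s : singularSet X _⦋n⦌, f.hom (simplexChain s) ∈ N)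
    (z : (singularChains X).X n) : f.hom z ∈ N := by
  let := Submodule.Quotient.module N
  have h0 : f ≫ ModuleCat.ofHom N.mkQ = 0 :=
    singularChains_hom_ext fun s => (Submodule.Quotient.mk_eq_zero N).2 (h s)
  exact (Submodule.Quotient.mk_eq_zero N).1 (congrArg (fun g => g.hom z) h0)

/-- In a path-connected space, an edge is homologous to a loop at a given point, up to a correction
depending linearly on its boundary. -/
theorem exists_edgeClass_sub_mem [PathConnectedSpace X] (x : X) :
    ∃ P : (singularChains X).X 0 ⟶ (singularChains X).opcycles 1, ∀ s : singularSet X _⦋1⦌,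
      ∃ γ : Path x x, edgeClass s - P.hom (((singularChains X).d 1 0).hom (simplexChain s)) =
        H₁ι X (loopClass γ) := by
  obtain ⟨l⟩ : Nonempty (∀ y : X, Path x y) := ⟨fun y => PathConnectedSpace.somePath x y⟩
  obtain ⟨g, hg⟩ : ∃ g : X → (singularChains X).opcycles 1, ∀ y, g y = pathClass (l y) :=
    ⟨_, fun _ => rfl⟩
  -- `P` sends a vertex `y` to the class of the chosen path from `x` to `y`; an edge is closed up to
  -- a loop by the paths to its two ends.
  obtain ⟨P, hP⟩ := exists_singularChains_hom (M := (singularChains X).opcycles 1)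
    fun v : singularSet X _⦋0⦌ => g (TopCat.toSSetObj₀Equiv v)
  have hP' : ∀ y : X, P.hom (simplexChain (TopCat.toSSetObj₀Equiv.symm y)) = g y := fun y => by
    rw [hP, Equiv.apply_symm_apply]
  refine ⟨P, fun s => ?_⟩
  obtain ⟨y, y', γ, rfl⟩ := exists_pathSimplex_eq s
  refine ⟨((l y).trans γ).trans (l y').symm, ?_⟩
  rw [d_pathSimplex, map_sub, hP', hP', hg, hg, H₁ι_loopClass, pathClass_trans, pathClass_trans,
    pathClass_symm]
  change pathClass γ - _ = _
  abel

/-- In a path-connected space, first homology is spanned by the classes of loops at a given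
point. -/
theorem span_loopClass [PathConnectedSpace X] (x : X) :
    Submodule.span ℤ (Set.range fun γ : Path x x => loopClass γ) = ⊤ := by
  obtain ⟨P, hP⟩ := exists_edgeClass_sub_mem x
  rw [eq_top_iff]
  intro h _
  obtain ⟨z, hz, hzh⟩ := exists_cycle h
  -- On a cycle the correction term vanishes, so its own class is a combination of loop classes.
  have hQ := mem_of_simplexChain_mem
    ((singularChains X).pOpcycles 1 - (singularChains X).d 1 0 ≫ P)
    ((Submodule.span ℤ (Set.range fun γ : Path x x => loopClass γ)).map (H₁ι X)) (fun s => by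
      obtain ⟨γ, hγ⟩ := hP s
      exact ⟨loopClass γ, Submodule.subset_span ⟨γ, rfl⟩, hγ.symm⟩) z
  obtain ⟨h', hh', he⟩ := hQ
  have e : H₁ι X h' = H₁ι X h := by
    refine he.trans ?_
    change ((singularChains X).pOpcycles 1).hom z - P.hom (((singularChains X).d 1 0).hom z) = _
    rw [hz, map_zero, sub_zero, hzh]
  exact H₁ι_injective e ▸ hh'

end Hurewicz

/-! ### Fundamental group and first homology of the circle -/

section Circle

/-- The class of the loop running once around the circle. -/
def circleGenerator : FundamentalGroup UnitAddCircle 0 :=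
  FundamentalGroup.fromPath
    (Path.Homotopic.Quotient.mk (circleLoop (ContinuousMap.id UnitAddCircle)))

/-- Every loop in the circle is homotopic to a power of the standard one. -/
theorem exists_zpow_circleLoop (x : FundamentalGroup UnitAddCircle 0) :
    ∃ n : ℤ, x = circleGenerator ^ n := by
  have hp := (AddCircle.isAddQuotientCoveringMap_coe (1 : ℝ)).toMultiplicative
  let e : ((↑) : ℝ → UnitAddCircle) ⁻¹' {0} := ⟨0, rfl⟩
  let u : AddSubgroup.zmultiples (1 : ℝ) := ⟨1, AddSubgroup.mem_zmultiples 1⟩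
  -- The standard loop lifts to the path from 0 to 1 in ℝ, so its monodromy is translation by 1,
  -- which generates the deck group.
  have hg : hp.fundamentalGroupToMulOpposite e circleGenerator = MulOpposite.op (Multiplicative.ofAdd u) := by
    rw [hp.fundamentalGroupToMulOpposite_apply_eq_Iff]
    let e' : ((↑) : ℝ → UnitAddCircle) ⁻¹' {0} := ⟨1, AddCircle.coe_period (1 : ℝ)⟩
    let Γ : Path (0 : ℝ) 1 := ⟨⟨fun t => (t : ℝ), by fun_prop⟩, by simp, by simp⟩
    have h := hp.isCoveringMap.monodromy_eq_of_map_eq (γ := circleGenerator) (ex := e) (ey := e')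
      (Path.Homotopic.Quotient.mk Γ) rfl
    rw [h]
    change (1 : ℝ) + 0 = 1
    simp
  obtain ⟨n, hn⟩ := AddSubgroup.mem_zmultiples_iff.1
    (hp.fundamentalGroupToMulOpposite e x).unop.toAdd.2
  refine ⟨n, hp.fundamentalGroupToMulOpposite_injective (e := e) ?_⟩
  refine Eq.trans ?_ (map_zpow (hp.fundamentalGroupToMulOpposite e) circleGenerator _).symm
  rw [hg]
  refine MulOpposite.unop_injective (Multiplicative.toAdd.injective (Subtype.ext ?_))
  rw [← hn]
  simp [u]

variable {C : Type u} [TopologicalSpace C]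

/-- The first homology of a circle is generated by the class of a parametrization. -/
theorem span_loopClass_circleLoop (e : UnitAddCircle ≃ₜ C) :
    Submodule.span ℤ {loopClass (circleLoop (e : C(UnitAddCircle, C)))} = ⊤ := by
  have : PathConnectedSpace C := e.surjective.pathConnectedSpace e.continuous
  rw [eq_top_iff, ← span_loopClass (e 0), Submodule.span_le]
  rintro _ ⟨δ, rfl⟩
  let δ' : Path (0 : UnitAddCircle) 0 :=
    (δ.map e.symm.continuous).cast (e.symm_apply_apply 0).symm (e.symm_apply_apply 0).symm
  obtain ⟨n, hn⟩ := exists_zpow_circleLoop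
    (FundamentalGroup.fromPath (Path.Homotopic.Quotient.mk δ'))
  have h := congrArg (fun x => hurewicz C (e 0) (FundamentalGroup.map (e : C(UnitAddCircle, C)) 0 x))
    hn
  simp only [map_zpow] at h
  have h1 : loopClass δ = n • loopClass (circleLoop (e : C(UnitAddCircle, C))) := by
    refine Eq.trans (loopClass_congr (pathClass_congr fun t => ?_))
      (congrArg Multiplicative.toAdd h)
    exact (e.apply_symm_apply _).symm
  change loopClass δ ∈ _
  rw [h1]
  exact zsmul_mem (Submodule.mem_span_singleton_self _) n

end Circle

/-! ### Local path-connectedness of the surface and its covering -/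

section LocallyPathConnected

theorem IsLocalHomeomorph.locallyPathConnectedSpace {E X : Type*} [TopologicalSpace E]
    [TopologicalSpace X] [LocallyPathConnectedSpace X] {p : E → X} (hp : IsLocalHomeomorph p) :
    LocallyPathConnectedSpace E := by
  rw [locallyPathConnectedSpace_iff_pathComponentIn_mem_nhds]
  intro x u hu hxu
  obtain ⟨q, hxq, -⟩ := hp x
  have hopen : IsOpen (q '' (q.source ∩ u)) :=
    q.isOpen_image_of_subset_source (q.open_source.inter hu) Set.inter_subset_left
  have hmem : q x ∈ q '' (q.source ∩ u) := Set.mem_image_of_mem _ ⟨hxq, hxu⟩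
  have hn := pathComponentIn_mem_nhds (hopen.mem_nhds hmem)
  have hsub : pathComponentIn (q '' (q.source ∩ u)) (q x) ⊆ q '' (q.source ∩ u) :=
    pathComponentIn_subset
  have ht : q '' (q.source ∩ u) ⊆ q.target := by
    rintro _ ⟨z, hz, rfl⟩
    exact q.map_source hz.1
  have hpc : IsPathConnected (q.symm '' pathComponentIn (q '' (q.source ∩ u)) (q x)) :=
    (isPathConnected_pathComponentIn hmem).image' (q.continuousOn_symm.mono (hsub.trans ht))
  refine Filter.mem_of_superset (q.symm.image_mem_nhds (x := q x) (q.map_source hxq) hn |> fun h => ?_)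
    (hpc.subset_pathComponentIn (F := u) (x := x) ⟨q x, mem_pathComponentIn_self hmem, q.left_inv hxq⟩ ?_)
  · simpa [q.left_inv hxq] using h
  · rintro _ ⟨z, hz, rfl⟩
    obtain ⟨w, hw, rfl⟩ := hsub hz
    rw [q.left_inv hw.1]
    exact hw.2

/-- The property passes from the convex disc to its quotient. It is what makes the connected
covering space path-connected. -/
theorem IsClosedOrientableSurface.locallyPathConnectedSpace {g : ℕ} {S : Type u}
    [TopologicalSpace S] (hS : IsClosedOrientableSurface g S) : LocallyPathConnectedSpace S := by
  obtain ⟨f⟩ := hS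
  have := (convex_closedBall (0 : ℂ) 1).locallyPathConnectedSpace
  exact f.isOpenEmbedding.locallyPathConnectedSpace

end LocallyPathConnected

/-! ### Closed lifts and components of preimages -/

section Covering

variable {E : Type u} {S : Type v} [TopologicalSpace E] [TopologicalSpace S]

theorem mapOfEq_injective {p : C(E, S)} (hp : IsCoveringMap p) {x₀ : S} {e₀ : E} (he : p e₀ = x₀) :
    Function.Injective (FundamentalGroup.mapOfEq p he) := by
  subst he
  intro a b h
  rw [FundamentalGroup.mapOfEq_apply, FundamentalGroup.mapOfEq_apply] at h
  simp only [Path.Homotopic.Quotient.cast_rfl_rfl] at h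
  exact hp.injective_path_homotopic_map e₀ e₀ h

/-- The class of a loop is invariant under conjugation by a path. -/
theorem hurewicz_conj {X : Type u} [TopologicalSpace X] {x y : X} (k : FundamentalGroup X x)
    (H : Path.Homotopic.Quotient x y) :
    hurewicz X y (H.symm.trans (Path.Homotopic.Quotient.trans k H)) = hurewicz X x k := by
  induction k using Quotient.inductionOn
  induction H
  refine congrArg Multiplicative.ofAdd (loopClass_congr ?_)
  rw [pathClass_trans, pathClass_trans, pathClass_symm]
  abel

/-- A loop in the base whose class lifts to a loop lifts to a closed curve. -/
theorem exists_circle_lift {p : C(E, S)} (hp : IsCoveringMap p) {x₀ : S} {y : E} (hy : p y = x₀)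
    (c : C(UnitAddCircle, S)) (hc : c 0 = x₀) (K : FundamentalGroup E y)
    (hK : FundamentalGroup.mapOfEq p hy K = FundamentalGroup.fromPath
      (Path.Homotopic.Quotient.mk ((circleLoop c).cast hc.symm hc.symm))) :
    ∃ c' : C(UnitAddCircle, E), p.comp c' = c ∧
      hurewicz E y K = Multiplicative.ofAdd (loopClass (circleLoop c')) := by
  subst hc
  have : LocallyPathConnectedSpace UnitAddCircle :=
    inferInstanceAs (LocallyPathConnectedSpace (Quotient _))
  -- Lifting criterion: the fundamental group of the circle is cyclic, so it suffices that the image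
  -- of its generator lies in the image of `p`.
  obtain ⟨c', ⟨rfl, hc'⟩, -⟩ := hp.existsUnique_continuousMap_lifts_of_range_le (f := c) (a₀ := 0)
    hy (by
      rintro _ ⟨x, rfl⟩
      obtain ⟨n, rfl⟩ := exists_zpow_circleLoop x
      rw [map_zpow]
      exact zpow_mem (MonoidHom.mem_range.2 ⟨K, hK⟩) n)
  obtain rfl : p.comp c' = c := ContinuousMap.ext fun z => congrFun hc' z
  refine ⟨c', rfl, ?_⟩
  rw [← hurewicz_mk]
  exact congrArg _ (mapOfEq_injective hp hy (Eq.trans hK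
    (FundamentalGroup.mapOfEq_apply p hy (FundamentalGroup.fromPath
      (Path.Homotopic.Quotient.mk (circleLoop c')))).symm))

theorem map_conj (p : C(E, S)) {x y : E} (k : FundamentalGroup E x)
    (H : Path.Homotopic.Quotient x y) :
    (H.symm.trans (Path.Homotopic.Quotient.trans k H)).map p =
      (H.map p).symm.trans (Path.Homotopic.Quotient.trans (Path.Homotopic.Quotient.map k p)
        (H.map p)) := by
  induction k using Quotient.inductionOn
  induction H
  refine congrArg Path.Homotopic.Quotient.mk ?_
  dsimp only
  rw [Path.map_trans, Path.map_trans, Path.map_symm]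

/-- Base point bookkeeping: transporting $grg^{-1}$ along $g^{-1}$ gives $r$, with endpoints equal
to `x` only propositionally. -/
theorem cast_conj {x a b : S} (ha : a = x) (hb : b = x) (g r : FundamentalGroup S x)
    (κ : FundamentalGroup S a) (α : Path.Homotopic.Quotient a b)
    (hκ : Path.Homotopic.Quotient.cast κ ha.symm ha.symm = g * r * g⁻¹)
    (hα : α = Path.Homotopic.Quotient.cast (g⁻¹ : FundamentalGroup S x) ha hb) :
    (α.symm.trans (Path.Homotopic.Quotient.trans κ α)).cast hb.symm hb.symm = r := by
  subst ha hb
  simp only [Path.Homotopic.Quotient.cast_rfl_rfl] at hκ hα ⊢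
  subst hκ hα
  change g⁻¹ * (g * r * g⁻¹) * (g⁻¹)⁻¹ = r
  group

/-- An element of the kernel conjugate to the class of a closed curve `c` has the homology class of
a closed lift of `c`. -/
theorem exists_lift_of_conj {p : C(E, S)} (hp : IsCoveringMap p) {x₀ : S} {e₀ : E}
    (he : p e₀ = x₀) {c : C(UnitAddCircle, S)} {r : FundamentalGroup S x₀} (hc : Represents c r)
    (g : FundamentalGroup S x₀) (k : FundamentalGroup E e₀)
    (hk : FundamentalGroup.mapOfEq p he k = g * r * g⁻¹) :
    ∃ c' : C(UnitAddCircle, E), p.comp c' = c ∧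
      hurewicz E e₀ k = Multiplicative.ofAdd (loopClass (circleLoop c')) := by
  obtain ⟨c₁, hc₁, ⟨F⟩, hr⟩ := hc
  let e : p ⁻¹' {x₀} := ⟨e₀, he⟩
  -- Moving `k` along the lift of $g^{-1}$ removes the conjugation: the new loop lies over `r`, and
  -- its homology class is unchanged.
  let H := hp.liftPathQuotient (g⁻¹ : FundamentalGroup S x₀) e
  have hy : p (hp.monodromy (g⁻¹ : FundamentalGroup S x₀) e) = x₀ :=
    (hp.monodromy (g⁻¹ : FundamentalGroup S x₀) e).2
  obtain ⟨c₂, hc₂, h₂⟩ := exists_circle_lift hp hy c₁ hc₁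
    (H.symm.trans (Path.Homotopic.Quotient.trans k H)) (by
      rw [hr]
      refine (FundamentalGroup.mapOfEq_apply p hy _).trans ?_
      rw [map_conj]
      exact cast_conj he hy g r (Path.Homotopic.Quotient.map k p) (H.map p)
        ((FundamentalGroup.mapOfEq_apply p he k).symm.trans hk) (hp.map_liftPathQuotient _ e))
  rw [hurewicz_conj] at h₂
  have hF : ∀ z, F.symm (0, z) = p (c₂ z) := fun z => by
    rw [F.symm.apply_zero, ← hc₂]; rfl
  -- The free homotopy, run backwards from `c₁` to `c`, lifts starting at `c₂` and ends in a closed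
  -- lift of `c`.
  let G := hp.liftHomotopy F.symm.toContinuousMap c₂ hF
  refine ⟨⟨fun z => G (1, z), by fun_prop⟩, ?_, ?_⟩
  · ext z
    exact (congrFun (hp.liftHomotopy_lifts F.symm.toContinuousMap c₂ hF) (1, z)).trans
      (F.symm.apply_one z)
  · rw [h₂]
    refine congrArg _ (loopClass_circleLoop_eq ⟨⟨G, fun z => ?_, fun z => rfl⟩⟩)
    exact hp.liftHomotopy_zero F.symm.toContinuousMap c₂ hF z

/-- The homology class of a closed lift of `c` is the class of a component of the preimage. -/
theorem loopClass_mem_preimageComponentClasses {p : C(E, S)} (hp : IsCoveringMap p)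
    {c : C(UnitAddCircle, S)} {c' : C(UnitAddCircle, E)} (hc' : p.comp c' = c) :
    loopClass (circleLoop c') ∈ preimageComponentClasses p c := by
  -- The lift is a section of the pullback over the circle. By uniqueness of lifts its image is
  -- clopen, hence the entire component.
  let s : C(UnitAddCircle, CurvePreimage p c) :=
    ⟨fun z => ⟨(z, c' z), by rw [← hc']; rfl⟩, by fun_prop⟩
  have hs : ∀ w ∈ connectedComponent (s 0), w.1.2 = c' w.1.1 := by
    let g₁ : CurvePreimage p c → E := fun w => w.1.2
    let g₂ : CurvePreimage p c → E := fun w => c' w.1.1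
    have h₁ : Continuous g₁ := by fun_prop
    have h₂ : Continuous g₂ := by fun_prop
    have h : p ∘ g₁ = p ∘ g₂ := funext fun w =>
      w.2.symm.trans (DFunLike.congr_fun hc' w.1.1).symm
    have hcl : IsClopen {w | g₁ w = g₂ w} :=
      ⟨hp.isSeparatedMap.isClosed_eqLocus h₁ h₂ h,
        hp.isLocalHomeomorph.isLocallyInjective.isOpen_eqLocus h₁ h₂ h⟩
    exact hcl.connectedComponent_subset rfl
  have hs' : ∀ z, s z ∈ connectedComponent (s 0) := fun z =>
    (isPreconnected_range s.continuous).subset_connectedComponent ⟨0, rfl⟩ ⟨z, rfl⟩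
  let e : UnitAddCircle ≃ₜ connectedComponent (s 0) :=
    { toFun := fun z => ⟨s z, hs' z⟩
      invFun := fun w => w.1.1.1
      left_inv := fun z => rfl
      right_inv := fun w => Subtype.ext (Subtype.ext (Prod.ext rfl (hs w.1 w.2).symm))
      continuous_toFun := by fun_prop
      continuous_invFun := by fun_prop }
  refine ⟨s 0, loopClass (circleLoop (e : C(UnitAddCircle, connectedComponent (s 0)))),
    span_loopClass_circleLoop e, ?_⟩
  rw [H₁map_loopClass]
  exact loopClass_congr (pathClass_congr fun t => rfl)

end Covering

/-! ### From a presentation of the quotient to normal generators of the kernel -/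

section DefiningRelations

variable {G : Type*} {D : Type w} [Group G] [Group D] {ι κ : Type*}

/-- A generating family of minimal cardinality is injective. -/
theorem injective_of_card_le [Fintype ι] {f : ι → D} (hf : Subgroup.closure (Set.range f) = ⊤)
    (hD : ∀ T : Finset D, Subgroup.closure (T : Set D) = ⊤ → Fintype.card ι ≤ T.card) :
    Function.Injective f := by
  classical
  have h := hD (Finset.univ.image f) (by simpa using hf)
  have hinj := Finset.card_image_iff.1 (le_antisymm Finset.card_image_le h)
  rwa [Finset.coe_univ, Set.injOn_univ] at hinj

/-- Injectivity is essential: were two letters to have the same image, the relation identifying them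
would be invisible among words on the set of images. -/
theorem ker_lift_eq_normalClosure {f : ι → D} (hf : Function.Injective f) {r : κ → FreeGroup ι}
    (hr : Subgroup.normalClosure (Set.range fun j => FreeGroup.map (Set.rangeFactorization f) (r j))
      = (FreeGroup.lift (fun x : Set.range f => (x : D))).ker) :
    (FreeGroup.lift f).ker = Subgroup.normalClosure (Set.range r) := by
  let e := FreeGroup.map (Set.rangeFactorization f)
  have he : Function.Bijective e :=
    (FreeGroup.freeGroupCongr (Equiv.ofInjective f hf)).bijective
  have h1 : Subgroup.normalClosure (Set.range fun j => e (r j)) =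
      (Subgroup.normalClosure (Set.range r)).map e := by
    rw [Subgroup.map_normalClosure _ _ he.2, ← Set.range_comp]
    rfl
  have h2 : FreeGroup.lift f = (FreeGroup.lift (fun x : Set.range f => (x : D))).comp e := by
    ext i
    simp [e]
  rw [h2, ← MonoidHom.comap_ker, ← hr, h1, Subgroup.comap_map_eq_self_of_injective he.1]

/-- If relators in the generators `t` of `G` define the quotient `φ : G → D` on the images of the
generators, then they normally generate the kernel of `φ`. -/
theorem ker_eq_normalClosure (φ : G →* D) {t : ι → G} (ht : Subgroup.closure (Set.range t) = ⊤)
    {r : κ → FreeGroup ι}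
    (hr : (FreeGroup.lift fun i => φ (t i)).ker = Subgroup.normalClosure (Set.range r)) :
    φ.ker = Subgroup.normalClosure (Set.range fun j => FreeGroup.lift t (r j)) := by
  have hs : Function.Surjective (FreeGroup.lift t) := by
    rw [← MonoidHom.range_eq_top, FreeGroup.range_lift_eq_closure, ht]
  have h : (FreeGroup.lift fun i => φ (t i)) = φ.comp (FreeGroup.lift t) := by
    ext i
    simp
  rw [h, ← MonoidHom.comap_ker] at hr
  rw [← Subgroup.map_comap_eq_self_of_surjective hs φ.ker, hr, Subgroup.map_normalClosure _ _ hs,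
    ← Set.range_comp]
  rfl

end DefiningRelations

/-! ### The spanning argument -/

/-- If the image of `π₁(E)` in `π₁(S)` is normally generated by classes of closed curves, then the
components of the preimages of these curves span the first homology of `E`. -/
theorem span_preimageComponentClasses {S : Type v} {E : Type u} [TopologicalSpace S]
    [TopologicalSpace E] [PathConnectedSpace E] {p : C(E, S)} (hp : IsCoveringMap p) {x₀ : S}
    {e₀ : E} (he : p e₀ = x₀) {κ : Type*} {ρ : κ → FundamentalGroup S x₀}
    (hρ : (FundamentalGroup.mapOfEq p he).range = Subgroup.normalClosure (Set.range ρ))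
    {c : κ → C(UnitAddCircle, S)} (hc : ∀ j, Represents (c j) (ρ j)) :
    Submodule.span ℤ (⋃ j, preimageComponentClasses p (c j)) = ⊤ := by
  let N := Submodule.span ℤ (⋃ j, preimageComponentClasses p (c j))
  -- `M` consists of the loops whose homology class lies in the span `N`; it remains to see that it
  -- is everything.
  let M : Subgroup (FundamentalGroup E e₀) :=
    (AddSubgroup.toSubgroup N.toAddSubgroup).comap (hurewicz E e₀)
  have hM : (FundamentalGroup.mapOfEq p he).range ≤ M.map (FundamentalGroup.mapOfEq p he) := by
    rw [hρ]
    -- A normal closure is the ordinary closure of all conjugates, so `M` only has to account for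
    -- each conjugate of a `ρ j`.
    refine (Subgroup.closure_le _).2 fun x hx => ?_
    obtain ⟨_, ⟨j, rfl⟩, hj⟩ := Group.mem_conjugatesOfSet_iff.1 hx
    obtain ⟨g, rfl⟩ := isConj_iff.1 hj
    obtain ⟨k, hk⟩ : g * ρ j * g⁻¹ ∈ (FundamentalGroup.mapOfEq p he).range := by
      rw [hρ]
      exact Subgroup.subset_closure hx
    refine ⟨k, ?_, hk⟩
    obtain ⟨c', hc', hk'⟩ := exists_lift_of_conj hp he (hc j) g k hk
    change hurewicz E e₀ k ∈ AddSubgroup.toSubgroup N.toAddSubgroup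
    rw [hk']
    exact Submodule.subset_span (s := ⋃ j, preimageComponentClasses p (c j))
      (Set.mem_iUnion.2 ⟨j, loopClass_mem_preimageComponentClasses hp hc'⟩)
  rw [eq_top_iff, ← span_loopClass e₀, Submodule.span_le]
  rintro _ ⟨γ, rfl⟩
  obtain ⟨k, hk, hkγ⟩ := hM ⟨FundamentalGroup.fromPath (Path.Homotopic.Quotient.mk γ), rfl⟩
  rw [mapOfEq_injective hp he hkγ] at hk
  exact hk

end

theorem lemma3p2 {S : Type v} {E : Type u} [TopologicalSpace S] [TopologicalSpace E]
    {D : Type w} [Group D] (g : ℕ) (hg : 1 ≤ g) (hS : IsClosedOrientableSurface g S)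
    -- the connected covering space, with base points
    [ConnectedSpace E] (p : C(E, S)) (hp : IsCoveringMap p) (x₀ : S) (e₀ : E) (he : p e₀ = x₀)
    -- the exact sequence `1 → π₁(E) → π₁(S) → D → 1`
    (φ : FundamentalGroup S x₀ →* D) (hφ : Function.Surjective φ)
    (hker : φ.ker = (FundamentalGroup.mapOfEq p he).range)
    -- the generators of the fundamental group of the surface
    (a b : Fin g → FundamentalGroup S x₀)
    (hab : Subgroup.closure (Set.range a ∪ Set.range b) = ⊤)
    -- `D` is not generated by fewer than `2 * g` elements
    (hD : ∀ T : Finset D, Subgroup.closure (T : Set D) = ⊤ → 2 * g ≤ T.card)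
    -- words in the `a i`, `b i` that map to a complete set of defining relations
    {k : ℕ} (r : Fin k → FreeGroup (Fin g ⊕ Fin g))
    (hr : IsCompleteSetOfDefiningRelations (Set.range fun s => φ (Sum.elim a b s))
      (Set.range fun j =>
        FreeGroup.map (Set.rangeFactorization fun s => φ (Sum.elim a b s)) (r j)))
    -- closed curves representing the words
    (c : Fin k → C(UnitAddCircle, S))
    (hc : ∀ j, Represents (c j) (FreeGroup.lift (Sum.elim a b) (r j))) :
    Submodule.span ℤ (⋃ j, preimageComponentClasses p (c j)) = ⊤ := by
  have := hS.locallyPathConnectedSpace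
  have := hp.isLocalHomeomorph.locallyPathConnectedSpace
  have := PathConnectedSpace.of_locallyPathConnectedSpace (X := E)
  refine span_preimageComponentClasses hp he
    (ρ := fun j => FreeGroup.lift (Sum.elim a b) (r j)) ?_ hc
  have hinj := injective_of_card_le hr.1 fun T hT => by
    simpa [two_mul] using hD T hT
  rw [← hker]
  exact ker_eq_normalClosure φ (by rw [Set.Sum.elim_range, hab])
    (ker_lift_eq_normalClosure hinj hr.2)
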